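/- Let $k\ge 2$. There exist constants $C_k,\tilde C_k\in(0,\infty)$, depending only on $k$, such that the following holds. Let $X=(X_i)_{i\ge 1}$ be a sequence of independent random variables with values in a measurable space $S$, and let $X^{(j)}=(X^{(j)}_i)_{i\ge1}$, $j=1,\dots,k$, be $k$ independent copies of the sequence $X$ (that is, the sequences $X^{(1)},\dots,X^{(k)}$ are mutually independent and each has the same law as $X$). Let $(B,\|\cdot\|)$ be a Banach space and, for every $(i_1,\dots,i_k)$, let $f_{i_1\dots i_k}:S^k\to B$ be a (strongly) measurable function. Then for all $n\ge k$ and all $t>0$, $$P\Big(\Big\|\sum f_{i_1\dots i_k}\big(X^{(1)}_{i_1},X^{(1)}_{i_2},\dots,X^{(1)}_{i_k}\big)\Big\|\ge t\Big)\le C_k\,P\Big(C_k\Big\|\sum f_{i_1\dots i_k}\big(X^{(1)}_{i_1},X^{(2)}_{i_2},\dots,X^{(k)}_{i_k}\big)\Big\|\ge t\Big),$$ where all sums are over all $k$-tuples $(i_1,\dots,i_k)$ of pairwise distinct indices in $\{1,\dots,n\}$. If in addition, for all pairwise distinct $i_1,\dots,i_k$ and every permutation $\pi$ of $\{1,\dots,k\}$,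 almost surely $$f_{i_1\dots i_k}(X_{i_1},\dots,X_{i_k})=f_{i_{\pi(1)}\dots i_{\pi(k)}}(X_{i_{\pi(1)}},\dots,X_{i_{\pi(k)}}),$$ then also for all $n\ge k$ and all $t>0$, $$P\Big(\Big\|\sum f_{i_1\dots i_k}\big(X^{(1)}_{i_1},X^{(2)}_{i_2},\dots,X^{(k)}_{i_k}\big)\Big\|\ge t\Big)\le \tilde C_k\,P\Big(\tilde C_k\Big\|\sum f_{i_1\dots i_k}\big(X^{(1)}_{i_1},X^{(1)}_{i_2},\dots,X^{(1)}_{i_k}\big)\Big\|\ge t\Big).$$ -/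

import Mathlib

open MeasureTheory ProbabilityTheory

/-- The index tuples `(i₁, …, i_k)` with `1 ≤ i_r ≤ n` and all of the `i_r` different. -/
def distinctIndices (k n : ℕ) : Finset (Fin k → ℕ) :=
  (Fintype.piFinset fun _ : Fin k => Finset.Icc 1 n).filter fun i => Function.Injective i

/-- The sum of `f_{i₁…i_k}(Y¹_{i₁}, …, Yᵏ_{i_k})` over all tuples of distinct indices in
`{1, …, n}`, where coordinate `r` of the kernels uses the sequence `Y r`. With `Y` constant in `r`
it is the U-statistic; with independent copies it is the decoupled U-statistic. -/
def kernelSum {k : ℕ} {Ω S B : Type*} [AddCommMonoid B]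
    (f : (Fin k → ℕ) → (Fin k → S) → B) (Y : Fin k → ℕ → Ω → S) (n : ℕ) (ω : Ω) : B :=
  ∑ i ∈ distinctIndices k n, f i (fun r => Y r (i r) ω)

/-- `Y 0, …, Y (k - 1)` are independent copies of the sequence `X`: as random elements of the
sequence space they are mutually independent, and each one has the law of `X`. The sequence `X`
may live on another probability space. -/
structure IsIndependentCopies {k : ℕ} {Ω₀ Ω S : Type*} [MeasurableSpace Ω₀] [MeasurableSpace Ω]
    [MeasurableSpace S] (Y : Fin k → ℕ → Ω → S) (μ : Measure Ω)
    (X : ℕ → Ω₀ → S) (μ₀ : Measure Ω₀) : Prop where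
  indep : iIndepFun (fun (r : Fin k) (ω : Ω) (i : ℕ) => Y r i ω) μ
  identDistrib : ∀ r : Fin k,
    IdentDistrib (fun (ω : Ω) (i : ℕ) => Y r i ω) (fun (ω : Ω₀) (i : ℕ) => X i ω) μ μ₀

/-- The almost sure symmetry of the kernels: for distinct indices, permuting the indices together
with the variables does not change the value. -/
def KernelSymmetric {k : ℕ} {Ω₀ S B : Type*} [MeasurableSpace Ω₀]
    (f : (Fin k → ℕ) → (Fin k → S) → B) (X : ℕ → Ω₀ → S) (μ₀ : Measure Ω₀) : Prop :=
  ∀ i : Fin k → ℕ, Function.Injective i → ∀ π : Equiv.Perm (Fin k),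
    ∀ᵐ ω ∂μ₀, f i (fun r => X (i r) ω) = f (fun r => i (π r)) (fun r => X (i (π r)) ω)

/-! Everything rests on one randomization. Given several copies of the sequence, choose at each
index `i` independently and uniformly a label in `A`, which decides the copies used at `i`. Since
the indices in a tuple are distinct, the mean of the resulting sum over the choices is the average
of the sums over all label tuples `a : Fin k → A`. For fixed data, a norming functional turns the
sum into a real function of degree at most `k` in the independent choices. Its fourth moment is
controlled by its variance (`LowDegree.fourth_moment_le`), so it reaches its mean with probability
bounded below (`tupleSum_mixture`). Conversely, for each fixed choice the sum has a known law, so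
the tail of the average is at most a constant times that tail (`copiesLaw_mixture_tail_le`).

It remains to write each side as a signed combination of at most `2 ^ k` such averages. For the
first inequality, `diagonal_eq_sum_replaceCopy` uses averages in which every selection yields `k`
independent copies. For the second, polarization (`sum_perm_eq_sum_finset`) uses averages in which
every selection yields one copy; symmetry identifies the sum over permutations with `k!` times the
decoupled sum. -/

open scoped BigOperators

/-! ### Moments of low-degree functions of independent uniform variables -/

section LowDegree

variable {A : Type*}

/-- A real function of `m` variables in `A` has degree at most `d` if it is a sum of functions of
at most `d` of the variables. This is expressed recursively through differences in the first
variable. -/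
def LowDegree : (m d : ℕ) → ((Fin m → A) → ℝ) → Prop
  | _, 0, g => ∀ x y, g x = g y
  | 0, _ + 1, _ => True
  | m + 1, d + 1, g => (∀ a : A, LowDegree m (d + 1) fun x => g (Fin.cons a x)) ∧
      ∀ a b : A, LowDegree m d fun x => g (Fin.cons a x) - g (Fin.cons b x)

theorem LowDegree.const (m d : ℕ) (c : ℝ) : LowDegree m d fun _ : Fin m → A => c := by
  induction m generalizing d c with
  | zero => cases d <;> simp [LowDegree]
  | succ m ih => cases d with
    | zero => simp [LowDegree]
    | succ d => exact ⟨fun _ => ih _ _, fun _ _ => ih _ _⟩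

theorem LowDegree.add {m d : ℕ} {g h : (Fin m → A) → ℝ} (hg : LowDegree m d g)
    (hh : LowDegree m d h) : LowDegree m d fun x => g x + h x := by
  induction m generalizing d with
  | zero => cases d with
    | zero => exact fun x y => congrArg₂ (· + ·) (hg x y) (hh x y)
    | succ d => trivial
  | succ m ih => cases d with
    | zero => exact fun x y => congrArg₂ (· + ·) (hg x y) (hh x y)
    | succ d =>
      refine ⟨fun a => ih (hg.1 a) (hh.1 a), fun a b => ?_⟩
      convert ih (hg.2 a b) (hh.2 a b) using 2
      ring

theorem LowDegree.const_mul {m d : ℕ} {g : (Fin m → A) → ℝ} (hg : LowDegree m d g) (c : ℝ) :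
    LowDegree m d fun x => c * g x := by
  induction m generalizing d with
  | zero => cases d with
    | zero => exact fun x y => congrArg (c * ·) (hg x y)
    | succ d => trivial
  | succ m ih => cases d with
    | zero => exact fun x y => congrArg (c * ·) (hg x y)
    | succ d =>
      refine ⟨fun a => ih (hg.1 a), fun a b => ?_⟩
      convert ih (hg.2 a b) using 2
      ring

theorem LowDegree.sum {m d : ℕ} {ι : Type*} (s : Finset ι) {g : ι → (Fin m → A) → ℝ}
    (hg : ∀ i ∈ s, LowDegree m d (g i)) : LowDegree m d fun x => ∑ i ∈ s, g i x := by
  classical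
  induction s using Finset.induction_on with
  | empty => simpa using LowDegree.const m d 0
  | insert i s hi ih =>
    simp only [Finset.sum_insert hi]
    exact (hg i (by simp)).add (ih fun j hj => hg j (by simp [hj]))

theorem LowDegree.expect {m d : ℕ} {ι : Type*} (s : Finset ι) {g : ι → (Fin m → A) → ℝ}
    (hg : ∀ i ∈ s, LowDegree m d (g i)) : LowDegree m d fun x => 𝔼 i ∈ s, g i x := by
  convert (LowDegree.sum s hg).const_mul (s.card : ℝ)⁻¹ using 2
  rw [Finset.expect_eq_sum_div_card, div_eq_inv_mul]

/-- A function of the variables in `D` has degree at most the cardinality of `D`. -/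
theorem LowDegree.of_dependsOn {m d : ℕ} {g : (Fin m → A) → ℝ} (D : Finset (Fin m))
    (hD : D.card ≤ d) (hg : ∀ x y, (∀ i ∈ D, x i = y i) → g x = g y) : LowDegree m d g := by
  induction m generalizing d with
  | zero => cases d with
    | zero => exact fun x y => by rw [Subsingleton.elim x y]
    | succ d => trivial
  | succ m ih => cases d with
    | zero =>
      intro x y
      have : D = ∅ := by simpa using hD
      exact hg x y (by simp [this])
    | succ d =>
      set D' : Finset (Fin m) := Finset.univ.filter fun i => i.succ ∈ D with hD'
      have hsub : D'.map (Fin.succEmb m) ⊆ D := by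
        intro i hi
        simp only [Finset.mem_map, hD', Finset.mem_filter] at hi
        obtain ⟨j, hj, rfl⟩ := hi
        exact hj.2
      have hcons : ∀ a, ∀ x y : Fin m → A, (∀ i ∈ D', x i = y i) →
          g (Fin.cons a x) = g (Fin.cons a y) := by
        intro a x y hxy
        refine hg _ _ fun i hi => ?_
        refine Fin.cases ?_ (fun j hj => ?_) i hi
        · intro _; rfl
        · simpa using hxy j (by simpa [hD'] using hj)
      have hcard : D'.card ≤ D.card := by
        simpa using Finset.card_le_card hsub
      refine ⟨fun a => ih D' (hcard.trans hD) (hcons a), fun a b => ?_⟩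
      -- If the first variable belongs to `D`, the difference depends on one variable fewer;
      -- otherwise the difference vanishes.
      by_cases h0 : (0 : Fin (m + 1)) ∈ D
      · refine ih D' ?_ fun x y hxy => by rw [hcons a x y hxy, hcons b x y hxy]
        have : (D'.map (Fin.succEmb m)).card < D.card := by
          refine Finset.card_lt_card ⟨hsub, fun h => ?_⟩
          have := h h0
          simp at this
        rw [Finset.card_map] at this
        omega
      · have : (fun x : Fin m → A => g (Fin.cons a x) - g (Fin.cons b x)) = fun _ => 0 := by
          funext x
          rw [sub_eq_zero]
          refine hg _ _ fun i hi => ?_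
          refine Fin.cases ?_ (fun j hj => ?_) i hi
          · intro h; exact absurd h h0
          · simp
        rw [this]
        exact LowDegree.const m d 0

variable [Fintype A]

theorem expect_fin_cons {m : ℕ} (g : (Fin (m + 1) → A) → ℝ) :
    𝔼 x, g x = 𝔼 a : A, 𝔼 x : Fin m → A, g (Fin.cons a x) := by
  rw [← Finset.expect_product' Finset.univ Finset.univ
    fun (a : A) (x : Fin m → A) => g (Fin.cons a x), Finset.univ_product_univ]
  exact (Fintype.expect_equiv (Fin.consEquiv fun _ => A) _ _ fun _ => rfl).symm

theorem expect_mul_sq_le {ι : Type*} [Fintype ι] (f g : ι → ℝ) :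
    (𝔼 i, f i * g i) ^ 2 ≤ (𝔼 i, f i ^ 2) * 𝔼 i, g i ^ 2 := by
  simp only [Finset.expect_eq_sum_div_card]
  rw [div_pow, div_mul_div_comm, ← sq]
  gcongr
  exact Finset.sum_mul_sq_le_sq_mul_sq _ _ _

variable [Nonempty A]

/-- The fourth moment of a function of low degree is controlled by its second moment. -/
theorem LowDegree.fourth_moment_le {m d : ℕ} {g : (Fin m → A) → ℝ} (hg : LowDegree m d g) :
    𝔼 x, g x ^ 4 ≤ (4 * Fintype.card A : ℝ) ^ (2 * d) * (𝔼 x, g x ^ 2) ^ 2 := by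
  have hN : (1 : ℝ) ≤ Fintype.card A := by exact_mod_cast Fintype.card_pos
  induction m generalizing d with
  | zero =>
    have h : ∀ F : (Fin 0 → A) → ℝ, 𝔼 x, F x = F Fin.elim0 := fun F => by
      rw [Finset.univ_unique, Finset.expect_singleton]
      exact congrArg F (Subsingleton.elim _ _)
    rw [h, h, ← pow_mul]
    have : (1 : ℝ) ≤ (4 * Fintype.card A : ℝ) ^ (2 * d) := one_le_pow₀ (by linarith)
    exact le_mul_of_one_le_left (by positivity) this
  | succ m ih => cases d with
    | zero =>
      obtain ⟨x₀⟩ : Nonempty (Fin (m + 1) → A) := inferInstance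
      have h : ∀ x, g x = g x₀ := fun x => hg x x₀
      simp only [h, Fintype.expect_const]
      apply le_of_eq; ring
    | succ d =>
      set M : ℝ := 4 * Fintype.card A with hM
      have hM4 : 4 ≤ M := by linarith
      -- Split `g` into its mean `u` over the first variable and the fluctuation `l`, which has mean
      -- zero in that variable and degree one less.
      set u : (Fin m → A) → ℝ := fun x => 𝔼 a : A, g (Fin.cons a x) with hu
      set l : A → (Fin m → A) → ℝ := fun a x => g (Fin.cons a x) - u x with hl
      have hu_deg : LowDegree m (d + 1) u := LowDegree.expect _ fun a _ => hg.1 a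
      have hl_deg : ∀ a, LowDegree m d (l a) := by
        intro a
        have : l a = fun x => 𝔼 b : A, (g (Fin.cons a x) - g (Fin.cons b x)) := by
          funext x
          rw [Finset.expect_sub_distrib, Fintype.expect_const]
        rw [this]
        exact LowDegree.expect _ fun b _ => hg.2 a b
      have hl_mean : ∀ x, 𝔼 a, l a x = 0 := by
        intro x
        simp only [hl]
        rw [Finset.expect_sub_distrib, Fintype.expect_const, sub_self]
      have hul : ∀ a x, g (Fin.cons a x) = u x + l a x := fun a x => by simp [hl]
      have hzero : ∀ F : (Fin m → A) → ℝ, 𝔼 a : A, 𝔼 x, F x * l a x = 0 := by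
        intro F
        rw [Finset.expect_comm]
        refine Finset.expect_eq_zero fun x _ => ?_
        rw [← Finset.mul_expect, hl_mean, mul_zero]
      set U : ℝ := 𝔼 x, u x ^ 2 with hU
      set v : A → ℝ := fun a => 𝔼 x, l a x ^ 2 with hv
      set Vv : ℝ := 𝔼 a, v a with hVv
      have hU0 : 0 ≤ U := Finset.expect_nonneg fun _ _ => sq_nonneg _
      have hv0 : ∀ a, 0 ≤ v a := fun a => Finset.expect_nonneg fun _ _ => sq_nonneg _
      have hV0 : 0 ≤ Vv := Finset.expect_nonneg fun a _ => hv0 a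
      have hsecond : 𝔼 x, g x ^ 2 = U + Vv := by
        rw [expect_fin_cons]
        have : ∀ a x, g (Fin.cons a x) ^ 2 = u x ^ 2 + 2 * u x * l a x + l a x ^ 2 := by
          intro a x; rw [hul]; ring
        simp only [this, Finset.expect_add_distrib, hzero, Fintype.expect_const]
        simp [hU, hVv, hv]
      have hu4 := ih hu_deg
      have hl4 := fun a => ih (hl_deg a)
      -- Cauchy–Schwarz with both induction hypotheses; the exponent is the mean of `2 * (d + 1)`
      -- and `2 * d`.
      have hcross : ∀ a, 𝔼 x, u x ^ 2 * l a x ^ 2 ≤ M ^ (2 * d + 1) * U * v a := by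
        intro a
        have h1 := expect_mul_sq_le (fun x => u x ^ 2) (fun x => l a x ^ 2)
        simp only [← pow_mul] at h1
        refine le_of_sq_le_sq (h1.trans ?_)
          (mul_nonneg (by positivity) (hv0 a))
        calc _ ≤ (M ^ (2 * (d + 1)) * U ^ 2) * (M ^ (2 * d) * v a ^ 2) := by
              refine mul_le_mul hu4 (hl4 a) 
                (Finset.expect_nonneg fun _ _ => Even.pow_nonneg (by decide) _)
                (by positivity)
          _ = _ := by ring
      -- The cardinality of `A` enters here: the size of the fluctuation may vary with `a`.
      have hv2 : 𝔼 a, v a ^ 2 ≤ Fintype.card A * Vv ^ 2 := by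
        have hs : ∑ a, v a ^ 2 ≤ (∑ a, v a) ^ 2 :=
          Finset.sum_sq_le_sq_sum_of_nonneg fun a _ => hv0 a
        have hN0 : (0 : ℝ) < Fintype.card A := by linarith
        rw [hVv, Fintype.expect_eq_sum_div_card, Fintype.expect_eq_sum_div_card, div_pow,
          mul_div_assoc', sq (Fintype.card A : ℝ), mul_div_mul_left _ _ hN0.ne']
        gcongr
      -- The slack in the pointwise bound for `(u + l) ^ 4` is `2 * l ^ 2 * (u - l) ^ 2`, and the
      -- term linear in `l` averages to zero.
      have hmain : 𝔼 x, g x ^ 4 ≤ 𝔼 x, u x ^ 4 + 8 * (𝔼 a, 𝔼 x, u x ^ 2 * l a x ^ 2)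
          + 3 * 𝔼 a, 𝔼 x, l a x ^ 4 := by
        rw [expect_fin_cons]
        calc _ ≤ 𝔼 a : A, 𝔼 x, (u x ^ 4 + 4 * u x ^ 3 * l a x + 8 * (u x ^ 2 * l a x ^ 2)
              + 3 * l a x ^ 4) := by
              refine Finset.expect_le_expect fun a _ => Finset.expect_le_expect fun x _ => ?_
              rw [hul]
              nlinarith [mul_nonneg (sq_nonneg (l a x)) (sq_nonneg (u x - l a x))]
          _ = _ := by
            simp only [Finset.expect_add_distrib, hzero, Fintype.expect_const,
              ← Finset.mul_expect, add_zero]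
      rw [hsecond]
      refine hmain.trans ?_
      have h8 : 𝔼 a, 𝔼 x, u x ^ 2 * l a x ^ 2 ≤ M ^ (2 * d + 1) * U * Vv := by
        rw [hVv, Finset.mul_expect]
        exact Finset.expect_le_expect fun a _ => hcross a
      have h3 : 𝔼 a, 𝔼 x, l a x ^ 4 ≤ M ^ (2 * d) * (Fintype.card A * Vv ^ 2) := by
        refine le_trans ?_ (mul_le_mul_of_nonneg_left hv2 (by positivity))
        rw [Finset.mul_expect]
        exact Finset.expect_le_expect fun a _ => hl4 a
      calc _ ≤ M ^ (2 * (d + 1)) * U ^ 2 + 8 * (M ^ (2 * d + 1) * U * Vv)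
            + 3 * (M ^ (2 * d) * (Fintype.card A * Vv ^ 2)) :=
            add_le_add (add_le_add hu4 (mul_le_mul_of_nonneg_left h8 (by norm_num)))
              (mul_le_mul_of_nonneg_left h3 (by norm_num))
        _ = M ^ (2 * d) * (M ^ 2 * U ^ 2 + 8 * M * (U * Vv) + 3 * Fintype.card A * Vv ^ 2) := by
          ring
        _ ≤ M ^ (2 * d) * (M ^ 2 * U ^ 2 + 2 * M ^ 2 * (U * Vv) + M ^ 2 * Vv ^ 2) := by
          have h2M : 8 * M ≤ 2 * M ^ 2 := by nlinarith only [hM4]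
          have hMN : 3 * (Fintype.card A : ℝ) ≤ M ^ 2 := by nlinarith only [hN, hM]
          exact mul_le_mul_of_nonneg_left (add_le_add (add_le_add le_rfl
            (mul_le_mul_of_nonneg_right h2M (mul_nonneg hU0 hV0)))
            (mul_le_mul_of_nonneg_right hMN (sq_nonneg _))) (by positivity)
        _ = _ := by ring

/-- A centred random variable with controlled fourth moment is nonnegative with probability
bounded below. -/
theorem expect_nonneg_indicator_ge {ι : Type*} [Fintype ι] [Nonempty ι] (W : ι → ℝ) {K : ℝ}
    (hK : 1 ≤ K) (h0 : 𝔼 i, W i = 0) (h4 : 𝔼 i, W i ^ 4 ≤ K * (𝔼 i, W i ^ 2) ^ 2) :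
    1 / (10 * K ^ 2) ≤ 𝔼 i, if 0 ≤ W i then (1 : ℝ) else 0 := by
  have hs0 : 0 ≤ 𝔼 i, W i ^ 2 := Finset.expect_nonneg fun _ _ => sq_nonneg _
  rcases hs0.eq_or_lt with hs | hs
  · have hW : ∀ i, W i = 0 := by
      have := (Finset.expect_eq_zero_iff_of_nonneg (s := Finset.univ)
        (f := fun i => W i ^ 2) fun _ _ => sq_nonneg _).1 hs.symm
      intro i
      simpa using this i (Finset.mem_univ i)
    simp only [hW, le_refl, if_true, Fintype.expect_const]
    rw [div_le_one (by positivity)]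
    nlinarith
  · set s := Real.sqrt (𝔼 i, W i ^ 2) with hs_def
    have hspos : 0 < s := Real.sqrt_pos.2 hs
    have hssq : s ^ 2 = 𝔼 i, W i ^ 2 := Real.sq_sqrt hs0
    set y : ι → ℝ := fun i => W i / s with hy
    have hy1 : 𝔼 i, y i = 0 := by
      simp only [hy]; rw [← Finset.expect_div, h0, zero_div]
    have hy2 : 𝔼 i, y i ^ 2 = 1 := by
      simp only [hy, div_pow]
      rw [← Finset.expect_div, ← hssq, div_self (by positivity)]
    have hy4 : 𝔼 i, y i ^ 4 ≤ K := by
      simp only [hy, div_pow]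
      rw [← Finset.expect_div, div_le_iff₀ (by positivity)]
      calc _ ≤ _ := h4
        _ = _ := by rw [← hssq]; ring
    -- The quartic test polynomial `K * y + y ^ 2 - y ^ 4 / (2 * K)` is nonpositive for `y < 0`, at
    -- most `5 * K ^ 2` for `y ≥ 0`, and has mean at least `1 / 2`.
    have hpt : ∀ i, 1 / (5 * K ^ 2) * (K * y i + y i ^ 2 - y i ^ 4 / (2 * K)) ≤
        if 0 ≤ W i then (1 : ℝ) else 0 := by
      intro i
      have hKp : 0 < K := by linarith
      generalize hyi : y i = q
      by_cases hW : 0 ≤ W i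
      · rw [if_pos hW, one_div_mul_eq_div, div_le_one (by positivity)]
        have hq : 0 ≤ q := by rw [← hyi]; exact div_nonneg hW hspos.le
        have h1 : q ^ 2 - q ^ 4 / (4 * K) ≤ K := by
          rw [sub_le_iff_le_add, ← sub_le_iff_le_add', le_div_iff₀ (by positivity)]
          nlinarith [sq_nonneg (q ^ 2 - 2 * K)]
        have h2 : K * q - q ^ 4 / (4 * K) ≤ 4 * K ^ 2 := by
          rw [sub_le_iff_le_add, ← sub_le_iff_le_add', le_div_iff₀ (by positivity)]
          by_cases hqK : q ≤ 4 * K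
          · have : K * q - 4 * K ^ 2 ≤ 0 := by nlinarith
            have : (K * q - 4 * K ^ 2) * (4 * K) ≤ 0 := by nlinarith
            exact this.trans (by positivity)
          · push Not at hqK
            have h3 : (4 * K) ^ 3 ≤ q ^ 3 := by gcongr
            have h5 : 4 * K ^ 2 ≤ q ^ 3 := by nlinarith [sq_nonneg K]
            have h6 : 4 * K ^ 2 * q ≤ q ^ 3 * q := by gcongr
            nlinarith [pow_pos hKp 3]
        have h7 : q ^ 4 / (2 * K) = q ^ 4 / (4 * K) + q ^ 4 / (4 * K) := by
          field_simp; ring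
        nlinarith
      · rw [if_neg hW]
        have hq : 0 ≤ -q := by
          rw [← hyi, neg_nonneg]; exact div_nonpos_of_nonpos_of_nonneg (not_le.1 hW).le hspos.le
        obtain ⟨p, rfl⟩ : ∃ p, q = -p := ⟨-q, by ring⟩
        rw [neg_neg] at hq
        refine mul_nonpos_of_nonneg_of_nonpos (by positivity) ?_
        have h1 : p - p ^ 3 / (2 * K) ≤ K := by
          rw [sub_le_iff_le_add, ← sub_le_iff_le_add', le_div_iff₀ (by positivity)]
          by_cases hpK : p ≤ K
          · have : (p - K) * (2 * K) ≤ 0 := by nlinarith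
            exact this.trans (by positivity)
          · push Not at hpK
            have h3 : p ^ 2 ≤ p ^ 3 := pow_le_pow_right₀ (hK.trans hpK.le) (by norm_num)
            nlinarith [sq_nonneg (p - K), sq_nonneg K]
        have h2 : p * (p - p ^ 3 / (2 * K)) ≤ p * K := by gcongr
        have h3 : p * (p - p ^ 3 / (2 * K)) = p ^ 2 - p ^ 4 / (2 * K) := by ring
        have h4 : (-p) ^ 4 = p ^ 4 := by ring
        rw [h4]
        nlinarith
    calc 1 / (10 * K ^ 2) ≤ 1 / (5 * K ^ 2) * (K * 0 + 1 - (𝔼 i, y i ^ 4) / (2 * K)) := by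
          have : (𝔼 i, y i ^ 4) / (2 * K) ≤ 1 / 2 := by
            rw [div_le_iff₀ (by positivity)]; linarith
          have h5 : 1 / (10 * K ^ 2) = 1 / (5 * K ^ 2) * (1 / 2) := by field_simp; norm_num
          rw [h5]
          gcongr
          linarith
      _ = 𝔼 i, 1 / (5 * K ^ 2) * (K * y i + y i ^ 2 - y i ^ 4 / (2 * K)) := by
          rw [← Finset.mul_expect, Finset.expect_sub_distrib, Finset.expect_add_distrib,
            ← Finset.mul_expect, hy1, hy2, Finset.expect_div]
      _ ≤ _ := Finset.expect_le_expect fun i _ => hpt i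

/-- The expectation of a function of the coordinates `i r`, for injective `i`. -/
theorem expect_comp_injective {J R : Type*} [Fintype J] [Fintype R] [DecidableEq J] [DecidableEq R]
    {i : R → J} (hi : Function.Injective i) (h : (R → A) → ℝ) :
    𝔼 σ : J → A, h (fun r => σ (i r)) = 𝔼 a : R → A, h a := by
  classical
  let e₁ := Equiv.piEquivPiSubtypeProd (fun j => j ∈ Set.range i) (fun _ : J => A)
  let e₂ : R ≃ Set.range i := Equiv.ofInjective i hi
  let e : (J → A) ≃ (R → A) × ({j // j ∉ Set.range i} → A) :=
    e₁.trans (Equiv.prodCongr (Equiv.arrowCongr e₂.symm (Equiv.refl A)) (Equiv.refl _))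
  rw [Fintype.expect_equiv e (fun σ => h fun r => σ (i r)) (fun p => h p.1) fun σ => rfl,
    ← Finset.univ_product_univ, Finset.expect_product]
  simp only [Fintype.expect_const]

end LowDegree

/-! ### Random selection of the entries of an array -/

section Mixture

variable {k : ℕ} {S B : Type*}

/-- The sum of the kernels evaluated at an array whose row `r` is inserted in coordinate `r`. -/
def tupleSum [AddCommMonoid B] (f : (Fin k → ℕ) → (Fin k → S) → B) (n : ℕ) (w : Fin k → ℕ → S) :
    B :=
  ∑ i ∈ distinctIndices k n, f i fun r => w r (i r)

/-- Choices are indexed by the finite type `Fin (n + 1)`, into which the indices `1, …, n` embed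
without wrapping around. -/
theorem ofNat_injOn_Icc (n : ℕ) : Set.InjOn (Fin.ofNat (n + 1)) (Finset.Icc 1 n) := by
  intro a ha b hb hab
  simp only [Finset.coe_Icc, Set.mem_Icc] at ha hb
  have := congrArg Fin.val hab
  simpa [Fin.ofNat, Nat.mod_eq_of_lt (Nat.lt_succ_of_le ha.2),
    Nat.mod_eq_of_lt (Nat.lt_succ_of_le hb.2)] using this

theorem injective_ofNat_of_mem_distinctIndices {n : ℕ} {i : Fin k → ℕ}
    (hi : i ∈ distinctIndices k n) : Function.Injective fun r => Fin.ofNat (n + 1) (i r) := by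
  simp only [distinctIndices, Finset.mem_filter, Fintype.mem_piFinset] at hi
  intro r s hrs
  exact hi.2 (ofNat_injOn_Icc n (hi.1 r) (hi.1 s) hrs)

variable [NormedAddCommGroup B] [NormedSpace ℝ B]

/-- If at each index `i` the entries of the array are selected by an independent uniform choice
`σ i` in `A`, then the sum is with probability bounded below at least as large in norm as its
mean. -/
theorem tupleSum_mixture {A : Type*} [Fintype A] [Nonempty A] {N : ℕ} (hN : Fintype.card A ≤ N)
    (f : (Fin k → ℕ) → (Fin k → S) → B) (n : ℕ) (v : Fin k → A → ℕ → S) :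
    1 / (10 * ((4 * N : ℝ) ^ (2 * k)) ^ 2) ≤ 𝔼 σ : Fin (n + 1) → A,
      if ‖((Fintype.card A : ℝ) ^ k)⁻¹ • ∑ a : Fin k → A, tupleSum f n fun r i => v r (a r) i‖ ≤
        ‖tupleSum f n fun r i => v r (σ (Fin.ofNat (n + 1) i)) i‖ then (1 : ℝ) else 0 := by
  set T : B := ((Fintype.card A : ℝ) ^ k)⁻¹ • ∑ a : Fin k → A, tupleSum f n fun r i => v r (a r) i
    with hT
  set Q : (Fin (n + 1) → A) → B := fun σ => tupleSum f n fun r i => v r (σ (Fin.ofNat (n + 1) i)) i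
    with hQ
  -- A norming functional for the mean `T` reduces the claim to the real variable `g (Q σ)`: if it
  -- is at least its mean `‖T‖`, then `‖Q σ‖ ≥ ‖T‖`.
  obtain ⟨g, hg1, hgT⟩ := exists_dual_vector'' ℝ T
  have hgT : g T = ‖T‖ := by simpa using hgT
  have hgQ : ∀ σ, g (Q σ) = ∑ i ∈ distinctIndices k n,
      g (f i fun r => v r (σ (Fin.ofNat (n + 1) (i r))) (i r)) := fun σ => by
    simp only [hQ, tupleSum, map_sum]
  have hdeg : LowDegree (n + 1) k fun σ => g (Q σ) + -‖T‖ := by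
    refine LowDegree.add ?_ (LowDegree.const _ _ _)
    simp only [hgQ]
    refine LowDegree.sum _ fun i _ => ?_
    refine LowDegree.of_dependsOn (Finset.univ.image fun r => Fin.ofNat (n + 1) (i r))
      (Finset.card_image_le.trans (by simp)) fun x y hxy => ?_
    congr 2
    funext r
    rw [hxy _ (Finset.mem_image_of_mem _ (Finset.mem_univ r))]
  -- Distinct indices make the labels in one summand independent and uniform, so its mean is the
  -- average over all `a`.
  have hmean : 𝔼 σ, (g (Q σ) + -‖T‖) = 0 := by
    rw [Finset.expect_add_distrib, Fintype.expect_const, ← hgT, add_neg_eq_zero]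
    simp only [hgQ]
    rw [Finset.expect_sum_comm, hT, map_smul, map_sum]
    simp only [tupleSum, map_sum]
    rw [Finset.sum_comm, Finset.smul_sum]
    refine Finset.sum_congr rfl fun i hi => ?_
    rw [expect_comp_injective (injective_ofNat_of_mem_distinctIndices hi)
      fun a => g (f i fun r => v r (a r) (i r)), Fintype.expect_eq_sum_div_card,
      Fintype.card_fun, Fintype.card_fin, div_eq_inv_mul, smul_eq_mul]
    push_cast
    rfl
  have hA : (1 : ℝ) ≤ Fintype.card A := by exact_mod_cast Fintype.card_pos
  have hNR : (Fintype.card A : ℝ) ≤ N := by exact_mod_cast hN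
  have h4 : 𝔼 σ, (g (Q σ) + -‖T‖) ^ 4 ≤
      (4 * N : ℝ) ^ (2 * k) * (𝔼 σ, (g (Q σ) + -‖T‖) ^ 2) ^ 2 :=
    hdeg.fourth_moment_le.trans (by gcongr)
  refine (expect_nonneg_indicator_ge _ (one_le_pow₀ (by linarith)) hmean h4).trans ?_
  refine Finset.expect_le_expect fun σ _ => ?_
  split_ifs with h1 h2 h2
  · exact le_rfl
  · refine absurd ?_ h2
    calc ‖T‖ ≤ g (Q σ) := by linarith
      _ ≤ ‖g (Q σ)‖ := Real.le_norm_self _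
      _ ≤ ‖g‖ * ‖Q σ‖ := g.le_opNorm _
      _ ≤ ‖Q σ‖ := mul_le_of_le_one_left (norm_nonneg _) hg1
  · exact zero_le_one
  · exact le_rfl

end Mixture

/-! ### Measurability of the sums -/

section Measurability

variable {k : ℕ} {S B : Type*} [NormedAddCommGroup B] [MeasurableSpace S]

theorem stronglyMeasurable_tupleSum {f : (Fin k → ℕ) → (Fin k → S) → B}
    (hf : ∀ i, StronglyMeasurable (f i)) (n : ℕ) : StronglyMeasurable (tupleSum f n) := by
  refine Finset.stronglyMeasurable_fun_sum _ fun i _ => (hf i).comp_measurable ?_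
  exact measurable_pi_lambda _ fun r => (measurable_pi_apply (i r)).comp (measurable_pi_apply r)

theorem measurableSet_tupleSum_tail {f : (Fin k → ℕ) → (Fin k → S) → B}
    (hf : ∀ i, StronglyMeasurable (f i)) (n : ℕ) (t L : ℝ) :
    MeasurableSet {w | t ≤ L * ‖tupleSum f n w‖} :=
  measurableSet_le measurable_const
    ((stronglyMeasurable_tupleSum hf n).norm.measurable.const_mul L)

end Measurability

/-! ### Averaging and union bounds for tails -/

section Tails

variable {Ω : Type*} [MeasurableSpace Ω]

/-- If every point of `E₀` lies in the random set `E s` with probability at least `c`, then the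
measure of `E₀` is controlled by those of the sets `E s`. -/
theorem mul_measureReal_le_of_expect_indicator {ι : Type*} [Fintype ι] [Nonempty ι]
    {P : Measure Ω} [IsFiniteMeasure P] {E₀ : Set Ω} {E : ι → Set Ω} (hE₀ : MeasurableSet E₀)
    (hE : ∀ s, MeasurableSet (E s)) {c p : ℝ}
    (h : ∀ ω ∈ E₀, c ≤ 𝔼 s, (E s).indicator (1 : Ω → ℝ) ω) (hp : ∀ s, P.real (E s) ≤ p) :
    c * P.real E₀ ≤ p := by
  have hint : ∀ s, Integrable ((E s).indicator (1 : Ω → ℝ)) P := fun s =>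
    (integrable_const (1 : ℝ)).indicator (hE s)
  calc c * P.real E₀ = ∫ ω, c * E₀.indicator (1 : Ω → ℝ) ω ∂P := by
        rw [integral_const_mul, integral_indicator_one hE₀]
    _ ≤ ∫ ω, 𝔼 s, (E s).indicator (1 : Ω → ℝ) ω ∂P := by
        refine integral_mono (((integrable_const (1 : ℝ)).indicator hE₀).const_mul c) ?_ ?_
        · simp only [Finset.expect_eq_sum_div_card]
          exact (integrable_finsetSum _ fun s _ => hint s).div_const _
        · intro ω
          by_cases hω : ω ∈ E₀
          · simpa [hω] using h ω hω
          · simp only [Set.indicator_of_notMem hω, mul_zero]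
            exact Finset.expect_nonneg fun s _ => Set.indicator_nonneg (by simp) _
    _ = 𝔼 s, P.real (E s) := by
        simp only [Finset.expect_eq_sum_div_card]
        rw [integral_div, integral_finsetSum _ fun s _ => hint s]
        simp only [integral_indicator_one (hE _)]
    _ ≤ 𝔼 _s : ι, p := Finset.expect_le_expect fun s _ => hp s
    _ = p := Fintype.expect_const p

/-- A sum reaching `t` has a term reaching `t / card D`; a union bound finishes. -/
theorem measureReal_tail_le_of_le_sum {D : Type*} [Fintype D] [Nonempty D] {P : Measure Ω}
    [IsFiniteMeasure P] {X : Ω → ℝ} {x : D → Ω → ℝ} {t q : ℝ} (h : ∀ᵐ ω ∂P, X ω ≤ ∑ d, x d ω)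
    (hq : ∀ d, P.real {ω | t ≤ Fintype.card D * x d ω} ≤ q) :
    P.real {ω | t ≤ X ω} ≤ Fintype.card D * q := by
  have hsub : {ω | t ≤ X ω} ≤ᵐ[P] ⋃ d, {ω | t ≤ Fintype.card D * x d ω} := by
    filter_upwards [h] with ω hω htX
    have htX : t ≤ X ω := htX
    by_contra hcon
    have hcon : ∀ d, Fintype.card D * x d ω < t := by
      intro d
      by_contra hd
      exact hcon (Set.mem_iUnion.2 ⟨d, not_lt.1 hd⟩)
    have h1 : ∑ d, Fintype.card D * x d ω < ∑ _d : D, t :=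
      Finset.sum_lt_sum_of_nonempty Finset.univ_nonempty fun d _ => hcon d
    rw [← Finset.mul_sum, Finset.sum_const, Finset.card_univ, nsmul_eq_mul] at h1
    have h2 := lt_of_mul_lt_mul_left h1 (Nat.cast_nonneg _)
    linarith
  calc P.real {ω | t ≤ X ω} ≤ P.real (⋃ d, {ω | t ≤ Fintype.card D * x d ω}) :=
        ENNReal.toReal_mono (measure_ne_top _ _) (measure_mono_ae hsub)
    _ ≤ ∑ d, P.real {ω | t ≤ Fintype.card D * x d ω} := measureReal_iUnion_fintype_le _
    _ ≤ ∑ _d : D, q := Finset.sum_le_sum fun d _ => hq d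
    _ = _ := by rw [Finset.sum_const, Finset.card_univ, nsmul_eq_mul]

end Tails

/-! ### Laws of selected copies -/

section Laws

variable {S : Type*} [MeasurableSpace S]

/-- The law of independent copies, indexed by `ι`, of a sequence of independent
variables with marginal laws `ν`. -/
noncomputable def copiesLaw (ι : Type*) (ν : ℕ → Measure S) : Measure (ι × ℕ → S) :=
  Measure.infinitePi fun p : ι × ℕ => ν p.2

variable {ι : Type*} {ν : ℕ → Measure S} [∀ i, IsProbabilityMeasure (ν i)]

instance : IsProbabilityMeasure (copiesLaw ι ν) := by
  unfold copiesLaw; infer_instance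

/-- The pairs `(φ i, i)` are distinct and the marginal law depends only on `i`, so switching copies
from index to index is invisible. -/
theorem copiesLaw_map_select (φ : ℕ → ι) :
    (copiesLaw ι ν).map (fun z i => z (φ i, i)) = Measure.infinitePi ν :=
  Measure.map_infinitePi_infinitePi_of_inj (P := fun p : ι × ℕ => ν p.2)
    (f := fun i => (φ i, i)) fun _ _ h => (Prod.ext_iff.1 h).2

/-- Injectivity at each index ensures that no entry is used by two rows, which keeps the rows
independent. -/
theorem copiesLaw_map_select_array {R : Type*} (φ : R → ℕ → ι)
    (hφ : ∀ i, Function.Injective fun r => φ r i) :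
    (copiesLaw ι ν).map (fun z r i => z (φ r i, i)) =
      Measure.infinitePi fun _ : R => Measure.infinitePi ν := by
  have h := Measure.map_infinitePi_infinitePi_of_inj (P := fun p : ι × ℕ => ν p.2)
    (f := fun q : R × ℕ => (φ q.1 q.2, q.2)) (by
      rintro ⟨r, i⟩ ⟨s, j⟩ hrs
      obtain ⟨h1, rfl⟩ := Prod.ext_iff.1 hrs
      exact Prod.ext (hφ i h1) rfl)
  rw [← Measure.infinitePi_map_curry (fun (_ : R) (i : ℕ) => ν i), ← h,
    Measure.map_map (MeasurableEquiv.measurable _) (by fun_prop)]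
  rfl

theorem IsIndependentCopies.map_row_eq {k : ℕ} {Ω₀ Ω : Type*} [MeasurableSpace Ω₀]
    [MeasurableSpace Ω] {μ₀ : Measure Ω₀} {μ : Measure Ω} {X : ℕ → Ω₀ → S}
    {Y : Fin k → ℕ → Ω → S} (hX : ∀ i, Measurable (X i)) (hind : iIndepFun X μ₀)
    (hY : IsIndependentCopies Y μ X μ₀) (r : Fin k) :
    μ.map (fun ω i => Y r i ω) = Measure.infinitePi fun i => μ₀.map (X i) := by
  rw [(hY.identDistrib r).map_eq]
  exact hind.map_fun_eq_infinitePi_map hX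

theorem IsIndependentCopies.map_eq {k : ℕ} {Ω₀ Ω : Type*} [MeasurableSpace Ω₀]
    [MeasurableSpace Ω] {μ₀ : Measure Ω₀} {μ : Measure Ω} {X : ℕ → Ω₀ → S}
    {Y : Fin k → ℕ → Ω → S} (hX : ∀ i, Measurable (X i)) (hind : iIndepFun X μ₀)
    (hY : IsIndependentCopies Y μ X μ₀) :
    μ.map (fun ω r i => Y r i ω) =
      Measure.infinitePi fun _ : Fin k => Measure.infinitePi fun i => μ₀.map (X i) := by
  rw [hY.indep.map_fun_eq_infinitePi_map₀' fun r => (hY.identDistrib r).aemeasurable_fst]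
  congr 1
  funext r
  exact hY.map_row_eq hX hind r

end Laws

/-! ### Algebraic expansions into averages -/

section Identities

/-- Expansion of `g b₀` when every `b₀ r` is a signed mixture of the points `φ r e`. -/
theorem sum_prod_smul_eq_of_mixture {R E I B : Type*} [Fintype R] [DecidableEq R] [Fintype E]
    [Fintype I] [DecidableEq I] [AddCommGroup B] [Module ℝ B] (wt : R → E → ℝ) (φ : R → E → I)
    (b₀ : R → I) (h : ∀ r b, (∑ e, if φ r e = b then wt r e else 0) = if b = b₀ r then 1 else 0)
    (g : (R → I) → B) :
    ∑ e : R → E, (∏ r, wt r (e r)) • g (fun r => φ r (e r)) = g b₀ := by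
  -- Expanding over all points `b` makes the sum over `e` factor into a product over coordinates.
  have h1 : ∀ e : R → E, (∏ r, wt r (e r)) • g (fun r => φ r (e r)) =
      ∑ b : R → I, (∏ r, if φ r (e r) = b r then wt r (e r) else 0) • g b := by
    intro e
    rw [Finset.sum_eq_single fun r => φ r (e r)]
    · simp
    · intro b _ hb
      obtain ⟨r, hr⟩ := Function.ne_iff.1 hb
      rw [Finset.prod_eq_zero (Finset.mem_univ r) (if_neg fun h => hr h.symm), zero_smul]
    · simp
  simp only [h1]
  rw [Finset.sum_comm]
  have h2 : ∀ b : R → I, ∑ e : R → E, (∏ r, if φ r (e r) = b r then wt r (e r) else 0) • g b =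
      (∏ r, if b r = b₀ r then (1 : ℝ) else 0) • g b := by
    intro b
    rw [← Finset.sum_smul, ← Fintype.prod_sum fun r e => if φ r e = b r then wt r e else 0]
    simp only [h]
  simp only [h2]
  rw [Finset.sum_eq_single b₀]
  · simp
  · intro b _ hb
    obtain ⟨r, hr⟩ := Function.ne_iff.1 hb
    rw [Finset.prod_eq_zero (Finset.mem_univ r) (if_neg hr), zero_smul]
  · simp

variable {k : ℕ}

/-- The copy used in coordinate `r` when the choice is `a`: the distinguished copy `none` if `a = r`
and `d` allows it, and the copy `some r` otherwise. -/
def replaceCopy (d : Fin k → Bool) (r a : Fin k) : Option (Fin k) :=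
  if d r = true ∧ a = r then none else some r

/-- One label puts the distinguished copy in at most one row, so a selected array still consists of
independent copies. -/
theorem replaceCopy_injective (d : Fin k → Bool) (a : Fin k) :
    Function.Injective fun r => replaceCopy d r a := by
  intro r s h
  simp only [replaceCopy] at h
  split_ifs at h with h1 h2 h2
  · exact h1.2.symm.trans h2.2
  · exact Option.some_injective _ h

/-- The weight of a coordinate in `diagonal_eq_sum_replaceCopy`. -/
noncomputable def replaceWeight (k : ℕ) (b : Bool) : ℝ := if b then 1 else -((k - 1) / k)

theorem abs_replaceWeight_le_one (b : Bool) : |replaceWeight k b| ≤ 1 := by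
  cases b
  · simp only [replaceWeight, Bool.false_eq_true, if_false, abs_neg]
    rcases Nat.eq_zero_or_pos k with rfl | hk
    · simp
    · have : (1 : ℝ) ≤ k := by exact_mod_cast hk
      rw [abs_of_nonneg (div_nonneg (by linarith) (by linarith)), div_le_one (by linarith)]
      linarith
  · simp [replaceWeight]

/-- In coordinate `r`, summing over labels gives `none` once and `some r` with multiplicity `k - 1`
if `d r` is true, and `some r` with multiplicity `k` otherwise. Subtracting `(k - 1) / k` times the
second from the first leaves `none`; the identity is the product over coordinates. -/
theorem diagonal_eq_sum_replaceCopy {B : Type*} [AddCommGroup B] [Module ℝ B]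
    (g : (Fin k → Option (Fin k)) → B) :
    g (fun _ => none) = ∑ d : Fin k → Bool, (∏ r, replaceWeight k (d r)) •
      ∑ a : Fin k → Fin k, g fun r => replaceCopy d r (a r) := by
  rw [← sum_prod_smul_eq_of_mixture (E := Bool × Fin k) (fun _ e => replaceWeight k e.1)
    (fun r e => if e.1 = true ∧ e.2 = r then none else some r) (fun _ => none) ?_ g]
  · simp only [Finset.smul_sum]
    rw [← Finset.sum_product', Finset.univ_product_univ]
    exact Fintype.sum_equiv (Equiv.arrowProdEquivProdArrow _ _ _) _ _ fun e => rfl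
  · intro r b
    have hk : (k : ℝ) ≠ 0 := by
      have := r.pos
      positivity
    rw [Fintype.sum_prod_type, Fintype.sum_bool]
    rcases b with _ | s
    · simp [replaceWeight]
    · by_cases hs : r = s
      · subst hs
        have h1 : ∑ a : Fin k, (if a = r then (0 : ℝ) else 1) = k - 1 := by
          have : ∀ a : Fin k, (if a = r then (0 : ℝ) else 1) = 1 - if a = r then 1 else 0 := by
            intro a; split_ifs <;> simp
          simp [this]
        simp only [replaceWeight]
        simp [h1]
        field_simp
        ring
      · simp [hs]

/-- The polarization identity. -/
theorem sum_perm_eq_sum_finset {B : Type*} [AddCommGroup B] [Module ℝ B]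
    (g : (Fin k → Fin k) → B) :
    ∑ π : Equiv.Perm (Fin k), g π =
      ∑ D : Finset (Fin k), ((-1 : ℝ) ^ Dᶜ.card) • ∑ a : Fin k → D, g fun r => a r := by
  classical
  have h1 : ∀ D : Finset (Fin k), ∑ a : Fin k → D, g (fun r => a r) =
      ∑ b : Fin k → Fin k, if ∀ r, b r ∈ D then g b else 0 := by
    intro D
    rw [← Finset.sum_filter, Finset.sum_subtype (p := fun b : Fin k → Fin k => ∀ r, b r ∈ D) _
      (by simp) g]
    exact (Fintype.sum_equiv (Equiv.subtypePiEquivPi (p := fun (_ : Fin k) (x : Fin k) => x ∈ D))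
      (fun b => g b) (fun a => g fun r => a r)
      fun _ => rfl).symm
  simp only [h1, Finset.smul_sum]
  rw [Finset.sum_comm]
  -- Inclusion–exclusion: the sets `D` that count are those containing the image of `b`, and their
  -- signs cancel unless the image is everything.
  have h2 : ∀ b : Fin k → Fin k,
      ∑ D : Finset (Fin k), ((-1 : ℝ) ^ Dᶜ.card) • (if ∀ r, b r ∈ D then g b else 0) =
        if Function.Bijective b then g b else 0 := by
    intro b
    have h3 : ∀ D : Finset (Fin k), ((-1 : ℝ) ^ Dᶜ.card) • (if ∀ r, b r ∈ D then g b else 0) =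
        (if Dᶜ ⊆ (Finset.univ.image b)ᶜ then ((-1 : ℝ) ^ Dᶜ.card) else 0) • g b := by
      intro D
      have : Dᶜ ⊆ (Finset.univ.image b)ᶜ ↔ ∀ r, b r ∈ D := by
        rw [Finset.compl_subset_compl, Finset.image_subset_iff]
        simp
      simp only [this]
      split_ifs <;> simp
    simp only [h3]
    rw [← Finset.sum_smul, Fintype.sum_equiv (compl_involutive.toPerm (compl : Finset (Fin k) → _))
      (fun D => if Dᶜ ⊆ (Finset.univ.image b)ᶜ then ((-1 : ℝ) ^ Dᶜ.card) else 0)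
      (fun E => if E ⊆ (Finset.univ.image b)ᶜ then ((-1 : ℝ) ^ E.card) else 0) fun _ => rfl,
      ← Finset.sum_filter]
    have h4 : (Finset.univ.filter fun E => E ⊆ (Finset.univ.image b)ᶜ) =
        (Finset.univ.image b)ᶜ.powerset := by ext; simp
    have h5 := congrArg (Int.cast : ℤ → ℝ)
      (Finset.sum_powerset_neg_one_pow_card (x := (Finset.univ.image b)ᶜ))
    push_cast at h5
    rw [h4, h5]
    have h6 : (Finset.univ.image b)ᶜ = ∅ ↔ Function.Bijective b := by
      rw [Finset.compl_eq_empty_iff, ← Finite.injective_iff_bijective,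
        Finite.injective_iff_surjective, Finset.eq_univ_iff_forall]
      simp [Function.Surjective]
    simp only [h6]
    split_ifs <;> simp
  simp only [h2]
  rw [← Finset.sum_filter]
  symm
  refine Finset.sum_bij (fun b hb => Equiv.ofBijective b (Finset.mem_filter.1 hb).2)
    (fun _ _ => Finset.mem_univ _) (fun b₁ _ b₂ _ h => ?_) (fun π _ => ?_) fun _ _ => rfl
  · exact congrArg (fun e : Equiv.Perm (Fin k) => (e : Fin k → Fin k)) h
  · exact ⟨π, Finset.mem_filter.2 ⟨Finset.mem_univ _, π.bijective⟩, Equiv.ext fun _ => rfl⟩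

end Identities

/-! ### Symmetric kernels -/

section Symmetry

variable {k : ℕ} {S B : Type*} [MeasurableSpace S] [NormedAddCommGroup B]
  {f : (Fin k → ℕ) → (Fin k → S) → B}

theorem distinctIndices_sum_comp_perm {M : Type*} [AddCommMonoid M] (n : ℕ)
    (π : Equiv.Perm (Fin k)) (F : (Fin k → ℕ) → M) :
    ∑ i ∈ distinctIndices k n, F (fun r => i (π r)) = ∑ i ∈ distinctIndices k n, F i := by
  refine Finset.sum_nbij' (fun i r => i (π r)) (fun i r => i (π.symm r)) ?_ ?_ ?_ ?_ ?_
  · intro i hi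
    simp only [distinctIndices, Finset.mem_filter, Fintype.mem_piFinset] at hi ⊢
    exact ⟨fun r => hi.1 _, hi.2.comp π.injective⟩
  · intro i hi
    simp only [distinctIndices, Finset.mem_filter, Fintype.mem_piFinset] at hi ⊢
    exact ⟨fun r => hi.1 _, hi.2.comp π.symm.injective⟩
  · intro i _; simp
  · intro i _; simp
  · intro i _; rfl

/-- For symmetric kernels the decoupled sum does not change when the copies are permuted. -/
theorem KernelSymmetric.tupleSum_perm {Ω₀ : Type*} [MeasurableSpace Ω₀] {μ₀ : Measure Ω₀}
    {X : ℕ → Ω₀ → S} (hsym : KernelSymmetric f X μ₀) (hX : ∀ i, Measurable (X i))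
    (hind : iIndepFun X μ₀) (hf : ∀ i, StronglyMeasurable (f i)) (n : ℕ)
    (π : Equiv.Perm (Fin k)) :
    ∀ᵐ z ∂copiesLaw (Fin k) (fun i => μ₀.map (X i)),
      (tupleSum f n fun r i => z (π r, i)) = tupleSum f n fun r i => z (r, i) := by
  have := hind.isProbabilityMeasure
  have : ∀ i, IsProbabilityMeasure (μ₀.map (X i)) := fun i =>
    Measure.isProbabilityMeasure_map (hX i).aemeasurable
  have hae : ∀ i ∈ distinctIndices k n, ∀ᵐ z ∂copiesLaw (Fin k) (fun i => μ₀.map (X i)),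
      f i (fun r => z (r, i r)) = f (fun r => i (π r)) (fun r => z (π r, i (π r))) := by
    intro i hi
    have hinj : Function.Injective i := (Finset.mem_filter.1 hi).2
    have hmeas : MeasurableSet {x : Fin k → S | f i x = f (fun r => i (π r)) fun r => x (π r)} := by
      have hsm : StronglyMeasurable fun x : Fin k → S => f (fun r => i (π r)) fun r => x (π r) :=
        (hf _).comp_measurable (by fun_prop)
      -- `B` carries no σ-algebra, so equality is tested through the real-valued norm of the
      -- difference.
      have : {x : Fin k → S | f i x = f (fun r => i (π r)) fun r => x (π r)} =
          (fun x => ‖f i x - f (fun r => i (π r)) fun r => x (π r)‖) ⁻¹' {0} := by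
        ext x; simp [sub_eq_zero]
      rw [this]
      exact ((hf i).sub hsm).norm.measurable (measurableSet_singleton 0)
    -- For distinct indices, entries taken from different copies have the same joint law as entries
    -- of one sequence, so the assumed symmetry transfers.
    have hlaw : (copiesLaw (Fin k) fun i => μ₀.map (X i)).map (fun z r => z (r, i r)) =
        μ₀.map fun ω r => X (i r) ω := by
      rw [(hind.precomp hinj).map_fun_eq_infinitePi_map fun r => hX (i r)]
      exact Measure.map_infinitePi_infinitePi_of_inj
        (P := fun p : Fin k × ℕ => μ₀.map (X p.2)) (f := fun r => (r, i r))
        fun _ _ h => (Prod.ext_iff.1 h).1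
    have h1 : ∀ᵐ x ∂μ₀.map (fun ω r => X (i r) ω),
        f i x = f (fun r => i (π r)) fun r => x (π r) :=
      (ae_map_iff (by fun_prop) hmeas).2 (hsym i hinj π)
    rw [← hlaw] at h1
    exact (ae_map_iff (by
      exact (measurable_pi_lambda _ fun r => measurable_pi_apply (r, i r)).aemeasurable) hmeas).1 h1
  filter_upwards [(Finset.eventually_all _).2 hae] with z hz
  simp only [tupleSum]
  rw [← distinctIndices_sum_comp_perm n π, Finset.sum_congr rfl hz]

end Symmetry

/-! ### The two tail comparisons -/

section Comparison

variable {k : ℕ} {S B ι : Type*} [MeasurableSpace S] [NormedAddCommGroup B] [NormedSpace ℝ B]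
  {ν : ℕ → Measure S} [∀ i, IsProbabilityMeasure (ν i)] {f : (Fin k → ℕ) → (Fin k → S) → B}

theorem copiesLaw_mixture_tail_le (hf : ∀ i, StronglyMeasurable (f i)) {A : Type*} [Fintype A]
    [Nonempty A] {N : ℕ} (hA : Fintype.card A ≤ N) (φ : Fin k → A → ι) (n : ℕ) {t L p : ℝ}
    (hL : 0 ≤ L)
    (hp : ∀ σ : ℕ → A, (copiesLaw ι ν).real
      {z | t ≤ L * ‖tupleSum f n fun r i => z (φ r (σ i), i)‖} ≤ p) :
    (copiesLaw ι ν).real {z | t ≤ L * ‖((Fintype.card A : ℝ) ^ k)⁻¹ • ∑ a : Fin k → A,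
        tupleSum f n fun r i => z (φ r (a r), i)‖} ≤
      10 * ((4 * N : ℝ) ^ (2 * k)) ^ 2 * p := by
  have hN : (0 : ℝ) < N := by exact_mod_cast Fintype.card_pos.trans_le hA
  have hsm : ∀ σ : Fin k → ℕ → ι,
      StronglyMeasurable fun z : ι × ℕ → S => tupleSum f n fun r i => z (σ r i, i) := fun σ =>
    (stronglyMeasurable_tupleSum hf n).comp_measurable (by fun_prop)
  have key := mul_measureReal_le_of_expect_indicator (P := copiesLaw ι ν)
    (E₀ := {z | t ≤ L * ‖((Fintype.card A : ℝ) ^ k)⁻¹ • ∑ a : Fin k → A,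
        tupleSum f n fun r i => z (φ r (a r), i)‖})
    (E := fun σ : Fin (n + 1) → A =>
      {z | t ≤ L * ‖tupleSum f n fun r i => z (φ r (σ (Fin.ofNat (n + 1) i)), i)‖})
    (c := 1 / (10 * ((4 * N : ℝ) ^ (2 * k)) ^ 2)) (p := p) ?_ ?_ ?_
    fun σ => hp fun i => σ (Fin.ofNat (n + 1) i)
  · rwa [one_div_mul_eq_div, div_le_iff₀ (by positivity), mul_comm] at key
  · refine measurableSet_le measurable_const (Measurable.const_mul ?_ L)
    exact ((Finset.stronglyMeasurable_fun_sum _ fun a _ =>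
      hsm fun r _ => φ r (a r)).const_smul _).norm.measurable
  · exact fun σ => measurableSet_le measurable_const ((hsm _).norm.measurable.const_mul L)
  · intro z hz
    refine (tupleSum_mixture hA f n fun r a i => z (φ r a, i)).trans
      (Finset.expect_le_expect fun σ _ => ?_)
    split_ifs with h
    · rw [Set.indicator_of_mem]
      · rfl
      · exact le_trans hz (mul_le_mul_of_nonneg_left h hL)
    · exact Set.indicator_nonneg (by simp) _

theorem norm_le_pow_mul_norm_inv_smul {A : Type*} [Fintype A] [Nonempty A] {N : ℕ}
    (hA : Fintype.card A ≤ N) (x : B) :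
    ‖x‖ ≤ (N : ℝ) ^ k * ‖((Fintype.card A : ℝ) ^ k)⁻¹ • x‖ := by
  have hpos : (0 : ℝ) < Fintype.card A := by exact_mod_cast Fintype.card_pos
  have hle : (Fintype.card A : ℝ) ≤ N := by exact_mod_cast hA
  calc ‖x‖ = (Fintype.card A : ℝ) ^ k * ‖((Fintype.card A : ℝ) ^ k)⁻¹ • x‖ := by
        rw [norm_smul, norm_inv, Real.norm_of_nonneg (by positivity),
          mul_inv_cancel_left₀ (by positivity)]
    _ ≤ _ := by gcongr

/-- The tail of the sum over a single copy is controlled by that of the decoupled sum. -/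
theorem copiesLaw_diagonal_tail_le (hk : 0 < k) (hf : ∀ i, StronglyMeasurable (f i)) (n : ℕ)
    (t : ℝ) :
    (Measure.infinitePi ν).real {x | t ≤ ‖tupleSum f n fun _ => x‖} ≤
      2 ^ k * (10 * ((4 * k : ℝ) ^ (2 * k)) ^ 2 *
        (Measure.infinitePi fun _ : Fin k => Measure.infinitePi ν).real
          {w | t ≤ 2 ^ k * k ^ k * ‖tupleSum f n w‖}) := by
  have : Nonempty (Fin k) := ⟨⟨0, hk⟩⟩
  -- The single sequence is realized as the copy `none`, next to `k` auxiliary copies `some r`.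
  have h0 : (Measure.infinitePi ν).real {x | t ≤ ‖tupleSum f n fun _ => x‖} =
      (copiesLaw (Option (Fin k)) ν).real {z | t ≤ ‖tupleSum f n fun _ i => z (none, i)‖} := by
    rw [← copiesLaw_map_select (fun _ => (none : Option (Fin k))),
      map_measureReal_apply (by fun_prop)]
    · rfl
    · exact measurableSet_le measurable_const ((stronglyMeasurable_tupleSum hf n).comp_measurable
        (by fun_prop)).norm.measurable
  rw [h0]
  have key := measureReal_tail_le_of_le_sum (P := copiesLaw (Option (Fin k)) ν)
    (D := Fin k → Bool) (X := fun z => ‖tupleSum f n fun _ i => z (none, i)‖)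
    (x := fun d z => (k : ℝ) ^ k * ‖((Fintype.card (Fin k) : ℝ) ^ k)⁻¹ • ∑ a : Fin k → Fin k,
      tupleSum f n fun r i => z (replaceCopy d r (a r), i)‖) (t := t)
    (q := 10 * ((4 * k : ℝ) ^ (2 * k)) ^ 2 *
        (Measure.infinitePi fun _ : Fin k => Measure.infinitePi ν).real
          {w | t ≤ 2 ^ k * k ^ k * ‖tupleSum f n w‖}) ?_ ?_
  · simpa using key
  · refine Filter.Eventually.of_forall fun z => ?_
    rw [diagonal_eq_sum_replaceCopy fun b => tupleSum f n fun r i => z (b r, i)]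
    refine (norm_sum_le _ _).trans (Finset.sum_le_sum fun d _ => ?_)
    refine le_trans ?_ (norm_le_pow_mul_norm_inv_smul (Fintype.card_fin k).le _)
    rw [norm_smul, norm_prod]
    exact mul_le_of_le_one_left (norm_nonneg _) (Finset.prod_le_one (fun _ _ => norm_nonneg _)
      fun r _ => abs_replaceWeight_le_one _)
  · intro d
    -- The `2 ^ k` terms of the expansion lower the threshold by this factor; `k ^ k` undoes the
    -- normalization of the average.
    have hcard : (Fintype.card (Fin k → Bool) : ℝ) = 2 ^ k := by simp
    simp only [hcard, ← mul_assoc]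
    refine copiesLaw_mixture_tail_le (ν := ν) hf (Fintype.card_fin k).le (replaceCopy d) n
      (t := t) (L := 2 ^ k * k ^ k) (by positivity) fun σ => ?_
    rw [← copiesLaw_map_select_array (fun r i => replaceCopy d r (σ i))
      fun i => replaceCopy_injective d (σ i), map_measureReal_apply (by fun_prop)
      (measurableSet_tupleSum_tail hf n t _)]
    rfl

/-- For symmetric kernels, the tail of the decoupled sum is controlled by that of the sum over a
single copy. -/
theorem KernelSymmetric.copiesLaw_tail_le {Ω₀ : Type*} [MeasurableSpace Ω₀] {μ₀ : Measure Ω₀}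
    {X : ℕ → Ω₀ → S} (hsym : KernelSymmetric f X μ₀) (hX : ∀ i, Measurable (X i))
    (hind : iIndepFun X μ₀) (hk : 0 < k) (hf : ∀ i, StronglyMeasurable (f i)) (n : ℕ) {t : ℝ}
    (ht : 0 < t) :
    (Measure.infinitePi fun _ : Fin k => Measure.infinitePi fun i => μ₀.map (X i)).real
        {w | t ≤ ‖tupleSum f n w‖} ≤
      2 ^ k * (10 * ((4 * k : ℝ) ^ (2 * k)) ^ 2 *
        (Measure.infinitePi fun i => μ₀.map (X i)).real
          {x | t ≤ 2 ^ k * k ^ k * ‖tupleSum f n fun _ => x‖}) := by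
  have := hind.isProbabilityMeasure
  have : ∀ i, IsProbabilityMeasure (μ₀.map (X i)) := fun i =>
    Measure.isProbabilityMeasure_map (hX i).aemeasurable
  set ν : ℕ → Measure S := fun i => μ₀.map (X i) with hν
  have : Nonempty (Fin k) := ⟨⟨0, hk⟩⟩
  have h0 : (Measure.infinitePi fun _ : Fin k => Measure.infinitePi ν).real
      {w | t ≤ ‖tupleSum f n w‖} =
      (copiesLaw (Fin k) ν).real {z | t ≤ ‖tupleSum f n fun r i => z (r, i)‖} := by
    rw [← copiesLaw_map_select_array (fun (r : Fin k) (_ : ℕ) => r)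
      (fun _ => Function.injective_id), map_measureReal_apply (by fun_prop)]
    · rfl
    · exact measurableSet_le measurable_const (stronglyMeasurable_tupleSum hf n).norm.measurable
  rw [h0]
  have key := measureReal_tail_le_of_le_sum (P := copiesLaw (Fin k) ν)
    (D := Finset (Fin k)) (X := fun z => ‖tupleSum f n fun r i => z (r, i)‖)
    (x := fun D z => (k : ℝ) ^ k * ‖((Fintype.card D : ℝ) ^ k)⁻¹ • ∑ a : Fin k → D,
      tupleSum f n fun r i => z ((a r : Fin k), i)‖) (t := t)
    (q := 10 * ((4 * k : ℝ) ^ (2 * k)) ^ 2 * (Measure.infinitePi ν).real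
          {x | t ≤ 2 ^ k * k ^ k * ‖tupleSum f n fun _ => x‖}) ?_ ?_
  · simpa using key
  · filter_upwards [Filter.eventually_all.2 fun π => hsym.tupleSum_perm hX hind hf n π] with z hz
    have hpol := sum_perm_eq_sum_finset fun b : Fin k → Fin k =>
      tupleSum f n fun r i => z (b r, i)
    simp only [hz, Finset.sum_const, Finset.card_univ, Fintype.card_perm, Fintype.card_fin] at hpol
    -- The factor `k!` from the sum over permutations is at least one and can be discarded.
    have hfac : (1 : ℝ) ≤ (Nat.factorial k : ℝ) := by exact_mod_cast Nat.factorial_pos k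
    calc ‖tupleSum f n fun r i => z (r, i)‖
        ≤ ‖Nat.factorial k • tupleSum f n fun r i => z (r, i)‖ := by
          rw [← Nat.cast_smul_eq_nsmul ℝ, norm_smul, Real.norm_of_nonneg (by positivity)]
          exact le_mul_of_one_le_left (norm_nonneg _) hfac
      _ ≤ _ := by
        rw [hpol]
        refine (norm_sum_le _ _).trans (Finset.sum_le_sum fun D _ => ?_)
        rw [norm_smul, norm_pow, norm_neg, norm_one, one_pow, one_mul]
        rcases D.eq_empty_or_nonempty with rfl | hD
        · simp
        · have : Nonempty D := hD.to_subtype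
          refine norm_le_pow_mul_norm_inv_smul ?_ _
          simpa using D.card_le_univ
  · intro D
    rcases D.eq_empty_or_nonempty with rfl | hD
    -- For empty `D` there are no labels and the average is zero, so `0 < t` makes the event empty.
    · have : {z : Fin k × ℕ → S | t ≤ Fintype.card (Finset (Fin k)) * ((k : ℝ) ^ k *
          ‖((Fintype.card (∅ : Finset (Fin k)) : ℝ) ^ k)⁻¹ • ∑ a : Fin k → (∅ : Finset (Fin k)),
            tupleSum f n fun r i => z ((a r : Fin k), i)‖)} = ∅ := by
        ext z
        simp [ht]
      rw [this, measureReal_empty]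
      positivity
    · have : Nonempty D := hD.to_subtype
      have hcard : Fintype.card D ≤ k := by simpa using D.card_le_univ
      simp only [Fintype.card_finset, Fintype.card_fin, Nat.cast_pow, Nat.cast_ofNat, ← mul_assoc]
      -- The label alone determines the copy, in every row, so each selection produces a single
      -- sequence with the law of `X`.
      refine copiesLaw_mixture_tail_le (ν := ν) hf hcard
        (fun _ (a : D) => (a : Fin k)) n (t := t) (L := 2 ^ k * k ^ k) (by positivity) fun σ => ?_
      rw [← copiesLaw_map_select (fun i => (σ i : Fin k)), map_measureReal_apply (by fun_prop)]
      · rfl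
      · exact measurableSet_le measurable_const (((stronglyMeasurable_tupleSum hf n).comp_measurable
          (by fun_prop)).norm.measurable.const_mul _)

end Comparison

/-! ### Assembly of the theorem -/

theorem mul_mul_measureReal_tail_le {Ω : Type*} [MeasurableSpace Ω] (P : Measure Ω)
    [IsFiniteMeasure P] {x : Ω → ℝ} (hx : ∀ ω, 0 ≤ x ω) {a b C t : ℝ} (ha₀ : 0 ≤ a)
    (ha : a ≤ C) (hb : b ≤ C) :
    a * P.real {ω | t ≤ b * x ω} ≤ C * P.real {ω | t ≤ C * x ω} :=
  mul_le_mul ha (measureReal_mono fun ω hω => le_trans (Set.mem_ofPred.1 hω)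
    (mul_le_mul_of_nonneg_right hb (hx ω))) measureReal_nonneg (ha₀.trans ha)

theorem theorem1 (k : ℕ) (hk : 2 ≤ k) :
    ∃ C C' : ℝ, 0 < C ∧ 0 < C' ∧
      ∀ (Ω₀ : Type*) [MeasurableSpace Ω₀] (μ₀ : Measure Ω₀) [IsProbabilityMeasure μ₀]
        (Ω : Type*) [MeasurableSpace Ω] (μ : Measure Ω) [IsProbabilityMeasure μ]
        (S : Type*) [MeasurableSpace S]
        (B : Type*) [NormedAddCommGroup B] [NormedSpace ℝ B] [CompleteSpace B]
        (X : ℕ → Ω₀ → S) (Y : Fin k → ℕ → Ω → S) (f : (Fin k → ℕ) → (Fin k → S) → B),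
        (∀ i, Measurable (X i)) → iIndepFun X μ₀ →
        IsIndependentCopies Y μ X μ₀ →
        (∀ i, StronglyMeasurable (f i)) →
        (∀ n : ℕ, k ≤ n → ∀ t : ℝ, 0 < t →
          μ.real {ω | t ≤ ‖kernelSum f (fun _ => Y ⟨0, Nat.lt_of_lt_of_le Nat.zero_lt_two hk⟩) n ω‖}
            ≤ C * μ.real {ω | t ≤ C * ‖kernelSum f Y n ω‖}) ∧
        (KernelSymmetric f X μ₀ → ∀ n : ℕ, k ≤ n → ∀ t : ℝ, 0 < t →
          μ.real {ω | t ≤ ‖kernelSum f Y n ω‖}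
            ≤ C' * μ.real {ω | t ≤ C' * ‖kernelSum f (fun _ => Y ⟨0, Nat.lt_of_lt_of_le Nat.zero_lt_two hk⟩) n ω‖}) := by
  have hk0 : 0 < k := by omega
  -- `a` is the number of terms times the inverse of the probability bound in `tupleSum_mixture`;
  -- `b` is the loss in the threshold. Enlarging both to `max a b` gives a single constant.
  set a : ℝ := 2 ^ k * (10 * ((4 * k : ℝ) ^ (2 * k)) ^ 2) with ha
  set b : ℝ := 2 ^ k * (k : ℝ) ^ k with hb
  have hapos : 0 < a := by positivity
  refine ⟨max a b, max a b, lt_max_of_lt_left hapos, lt_max_of_lt_left hapos, ?_⟩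
  intro Ω₀ _ μ₀ _ Ω _ μ _ S _ B _ _ _ X Y f hX hind hY hf
  have : ∀ i, IsProbabilityMeasure (μ₀.map (X i)) := fun i =>
    Measure.isProbabilityMeasure_map (hX i).aemeasurable
  set r₀ : Fin k := ⟨0, Nat.lt_of_lt_of_le Nat.zero_lt_two hk⟩
  have hdec : ∀ n (t L : ℝ), μ.real {ω | t ≤ L * ‖kernelSum f Y n ω‖} =
      (Measure.infinitePi fun _ : Fin k => Measure.infinitePi fun i => μ₀.map (X i)).real
        {w | t ≤ L * ‖tupleSum f n w‖} := by
    intro n t L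
    have hmeas : AEMeasurable (fun ω r i => Y r i ω) μ :=
      aemeasurable_pi_iff.2 fun r => (hY.identDistrib r).aemeasurable_fst
    rw [← hY.map_eq hX hind, measureReal_def, measureReal_def,
      Measure.map_apply_of_aemeasurable hmeas (measurableSet_tupleSum_tail hf n t L)]
    rfl
  have hdiag : ∀ n (t L : ℝ), μ.real {ω | t ≤ L * ‖kernelSum f (fun _ => Y r₀) n ω‖} =
      (Measure.infinitePi fun i => μ₀.map (X i)).real
        {x | t ≤ L * ‖tupleSum f n fun _ => x‖} := by
    intro n t L
    have hset : MeasurableSet {x : ℕ → S | t ≤ L * ‖tupleSum f n fun _ => x‖} :=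
      (measurable_pi_lambda (fun (x : ℕ → S) (_ : Fin k) => x) fun _ => measurable_id)
        (measurableSet_tupleSum_tail hf n t L)
    rw [← hY.map_row_eq hX hind r₀, measureReal_def, measureReal_def,
      Measure.map_apply_of_aemeasurable (hY.identDistrib r₀).aemeasurable_fst hset]
    rfl
  refine ⟨fun n _ t _ => ?_, fun hsym n _ t ht => ?_⟩
  · refine le_trans ?_ (mul_mul_measureReal_tail_le μ (fun ω => norm_nonneg _) hapos.le
      (le_max_left a b) (le_max_right a b))
    have h := copiesLaw_diagonal_tail_le (ν := fun i => μ₀.map (X i)) hk0 hf n t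
    have h1 := hdiag n t 1
    simp only [one_mul] at h1
    rw [h1, hdec, ha, mul_assoc]
    exact h
  · refine le_trans ?_ (mul_mul_measureReal_tail_le μ (fun ω => norm_nonneg _) hapos.le
      (le_max_left a b) (le_max_right a b))
    have h := hsym.copiesLaw_tail_le hX hind hk0 hf n ht
    have h1 := hdec n t 1
    simp only [one_mul] at h1
    rw [h1, hdiag, ha, mul_assoc]
    exact h
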